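/- \textbf{Theorem.} Fix an integer $d$. For $p$ features consider the probit latent factor model $Y_{ij}=I(e_{ij}>c_j)$, $1\le i\le n$, $1\le j\le p$, $e_i=BZ_i+\varepsilon_i$, where $B\in\mathbb R^{p\times d}$ is the loading matrix (rows $b_j^\top$), $\mathrm{cov}(Z_i)=I_d$, $E\varepsilon_i=0$, $\mathrm{cov}(\varepsilon_i)=D=\mathrm{diag}(\tau_1^2,\dots,\tau_p^2)$, $Z_i$ and $\varepsilon_i$ are uncorrelated, and $e_1,\dots,e_n$ are independent $N(0,\Sigma)$ vectors with $\Sigma=(\sigma_{jk})=BB^\top+D$ and $\sigma_{jj}=\|b_j\|^2+\tau_j^2=1$. Let $P_j=P(Y_{ij}=1)$, $P_{jk}=P(Y_{ij}=Y_{ik}=1)$ and $\Sigma_B=B^\top B/p$. Assume that there are constants, not depending on $p$ or $n$, such that for all $j,k\le p$: (C1) $0<P^{(1)}_{\min}\le P_j\le P^{(1)}_{\max}<1$; (C2) $0<P^{(2)}_{\min}\le P_{jk}\le P^{(2)}_{\max}<1$; (C3) $0<\tau_{\min}\le\tau_j\le\tau_{\max}<1$; and that $\Sigma_B$ is positive definite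 uniformly in $p$: its smallest eigenvalue is at least a constant $\lambda>0$. For a $p\times d$ matrix $A$ of rank $d$ let $H_A=A(A^\top A)^{-1}A^\top$, and let $\mathcal D(A,C)=\mathrm{tr}\{(H_A-H_C)^2\}$. Let $\Sigma_d$ (resp. $\widehat\Sigma_d$) be a $p\times d$ matrix whose columns are orthonormal eigenvectors of $\Sigma$ (resp. $\widehat\Sigma$) for its $d$ largest eigenvalues, chosen arbitrarily in case of ties. Here $\widehat\Sigma$ is the moment estimator with $\widehat\sigma_{jj}=1$ and, for $j\ne k$, $\widehat\sigma_{jk}\in(-1,1)$ the solution of $\ell(\widehat c_j,\widehat c_k;\widehat\sigma_{jk})=\widehat P_{jk}$, where $\widehat P_j=n^{-1}\sum_i I(Y_{ij}=1)$, $\widehat P_{jk}=n^{-1}\sum_i I(Y_{ij}=Y_{ik}=1)$, $\widehat c_j=-\Phi^{-1}(\widehat P_j)$, $\Phi$ is the standard normal distribution function, and $$\ell(c,c';\sigma)=\frac1{2\pi\sqrt{1-\sigma^2}}\int_{c}^\infty\int_{c'}^\infty\exp\Big\{-\frac{x^2+y^2-2\sigma xy}{2(1-\sigma^2)}\Big\}\,dy\,dx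 ;$$ where $\Phi^{-1}(\widehat P_j)$ or the solution does not exist, a fixed arbitrary value is used. (1) \emph{Asymptotic identifiability.} For models indexed by $p$ that satisfy these conditions, $\mathcal D(B,\Sigma_d)\to0$ as $p\to\infty$. (2) \emph{Consistency.} Suppose that $p=p_n\to\infty$ as $n\to\infty$ and (C4) $p_n\le\rho n^{\xi}$ for some constants $\rho>0$ and $0<\xi<1/2$. For models, one for each $n$, that satisfy these conditions, $\mathcal D(B,\widehat\Sigma_d)\to0$ in probability as $n\to\infty$. -/

import Mathlib

open MeasureTheory ProbabilityTheory Filter Topology Set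

noncomputable section

/-! ### Linear algebra -/

/-- The matrix `H_A = A (Aᵀ A)⁻¹ Aᵀ` of the orthogonal projection onto the column space of `A`
(for `A` of full column rank). -/
def projMatrix {p d : ℕ} (A : Matrix (Fin p) (Fin d) ℝ) : Matrix (Fin p) (Fin p) ℝ :=
  A * (A.transpose * A)⁻¹ * A.transpose

/-- The projection discrepancy `𝒟(A, C) = tr {(H_A - H_C)²}`. -/
def discrepancy {p d : ℕ} (A C : Matrix (Fin p) (Fin d) ℝ) : ℝ :=
  ((projMatrix A - projMatrix C) ^ 2).trace

/-- The columns of `V` are orthonormal, and the `k`-th column is an eigenvector of the symmetric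
matrix `S` for its `k`-th largest eigenvalue (eigenvalues repeated according to multiplicity, in
decreasing order, for `k = 1, …, d`). -/
def IsTopEigenvectors {p d : ℕ} (S : Matrix (Fin p) (Fin p) ℝ)
    (V : Matrix (Fin p) (Fin d) ℝ) : Prop :=
  V.transpose * V = 1 ∧
    ∃ hS : S.IsHermitian, ∀ k : Fin d, ∃ hk : (k : ℕ) < Fintype.card (Fin p),
      S.mulVec (V.col k) = hS.eigenvalues₀ ⟨k, hk⟩ • V.col k

/-! ### The model -/

/-- The parameters of a probit latent factor model with `p` binary features and `d` factors: the
loading matrix `B`, the thresholds `c j`, and the standard deviations `τ j` of the errors. The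
latent variables `e_j = ∑ k, B j k * Z_k + ε_j` have variance one. -/
structure ProbitFactorModel (d p : ℕ) where
  B : Matrix (Fin p) (Fin d) ℝ
  c : Fin p → ℝ
  τ : Fin p → ℝ
  unit_variance : ∀ j, ∑ k, B j k ^ 2 + τ j ^ 2 = 1

namespace ProbitFactorModel

variable {d p : ℕ} (M : ProbitFactorModel d p)

/-- `Σ = B Bᵀ + D` with `D = diag(τ₁², …, τ_p²)`. -/
def Sigma : Matrix (Fin p) (Fin p) ℝ :=
  M.B * M.B.transpose + Matrix.diagonal (fun j => M.τ j ^ 2)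

/-- `Σ_B = Bᵀ B / p`. -/
def SigmaB : Matrix (Fin d) (Fin d) ℝ :=
  (p : ℝ)⁻¹ • (M.B.transpose * M.B)

/-- The law `N(0, Σ)` of the latent vector `e`. -/
def law : Measure (EuclideanSpace ℝ (Fin p)) :=
  multivariateGaussian 0 M.Sigma

/-- `P_j = P(Y_j = 1) = P(e_j > c_j)`. -/
def prob (j : Fin p) : ℝ :=
  M.law.real {x | M.c j < x j}

/-- `P_{j₁ j₂} = P(Y_{j₁} = Y_{j₂} = 1) = P(e_{j₁} > c_{j₁}, e_{j₂} > c_{j₂})`. -/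
def prob₂ (j₁ j₂ : Fin p) : ℝ :=
  M.law.real {x | M.c j₁ < x j₁ ∧ M.c j₂ < x j₂}

/-- The regularity conditions on the parameters, with given constants. -/
structure Regular (P₁min P₁max P₂min P₂max τmin τmax lam : ℝ) : Prop where
  /-- Univariate probabilities. -/
  univariate : ∀ j, P₁min ≤ M.prob j ∧ M.prob j ≤ P₁max
  /-- Bivariate probabilities. -/
  bivariate : ∀ j₁ j₂, P₂min ≤ M.prob₂ j₁ j₂ ∧ M.prob₂ j₁ j₂ ≤ P₂max
  /-- Standard deviations of the errors. -/
  errors : ∀ j, τmin ≤ M.τ j ∧ M.τ j ≤ τmax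
  /-- All eigenvalues of `Σ_B` are at least `lam`. -/
  loadings : (M.SigmaB - lam • (1 : Matrix (Fin d) (Fin d) ℝ)).PosSemidef

variable {Ω : Type*}

/-- The latent vector `e_i = B Z_i + ε_i` of an observation. -/
def latent (Z : Ω → Fin d → ℝ) (ε : Ω → Fin p → ℝ) (ω : Ω) : Fin p → ℝ :=
  M.B.mulVec (Z ω) + ε ω

/-- `Z i`, `ε i` for `i = 1, …, n` are the latent factors and the errors of `n` independent
observations from the model: the factors have covariance `I_d`, the errors have mean zero and
covariance `D` and are uncorrelated with the factors, and the vectors `e_i = B Z_i + ε_i` are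
independent centred Gaussian vectors. -/
structure IsSample {n : ℕ} [MeasurableSpace Ω] (μ : Measure Ω)
    (Z : Fin n → Ω → Fin d → ℝ) (ε : Fin n → Ω → Fin p → ℝ) : Prop where
  memLp_factor : ∀ i k, MemLp (fun ω => Z i ω k) 2 μ
  memLp_error : ∀ i j, MemLp (fun ω => ε i ω j) 2 μ
  mean_error : ∀ i j, ∫ ω, ε i ω j ∂μ = 0
  cov_factor : ∀ i k l,
    cov[fun ω => Z i ω k, fun ω => Z i ω l; μ] = if k = l then 1 else 0
  cov_error : ∀ i j l,
    cov[fun ω => ε i ω j, fun ω => ε i ω l; μ] = if j = l then M.τ j ^ 2 else 0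
  cov_factor_error : ∀ i k j, cov[fun ω => Z i ω k, fun ω => ε i ω j; μ] = 0
  gaussian_latent : ∀ i, HasGaussianLaw (M.latent (Z i) (ε i)) μ
  mean_latent : ∀ i j, ∫ ω, M.latent (Z i) (ε i) ω j ∂μ = 0
  indep_latent : iIndepFun (fun i => M.latent (Z i) (ε i)) μ

/-- The binary observation `Y_j = I(e_j > c_j)`. -/
def binary (Z : Ω → Fin d → ℝ) (ε : Ω → Fin p → ℝ) (ω : Ω) (j : Fin p) : Bool :=
  open Classical in decide (M.c j < M.latent Z ε ω j)

end ProbitFactorModel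

/-! ### The moment estimator -/

/-- The inverse `Φ⁻¹` of the standard normal distribution function
(with an arbitrary value outside the range `(0, 1)` of `Φ`). -/
def normalQuantile : ℝ → ℝ :=
  Function.invFun (fun x => cdf (gaussianReal 0 1) x)

/-- The upper bivariate normal tail probability `ℓ(c₁, c₂; σ)`, for `|σ| < 1`. -/
def ell (c₁ c₂ σ : ℝ) : ℝ :=
  1 / (2 * Real.pi * √(1 - σ ^ 2)) *
    ∫ x in Ioi c₁, ∫ y in Ioi c₂,
      Real.exp (-((x ^ 2 + y ^ 2 - 2 * σ * x * y) / (2 * (1 - σ ^ 2))))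

/-- `ℓ⁻¹(c₁, c₂; P)`, the `σ ∈ (-1, 1)` with `ℓ(c₁, c₂; σ) = P`
(with an arbitrary value where there is none). -/
def ellInv (c₁ c₂ P : ℝ) : ℝ :=
  Function.invFunOn (ell c₁ c₂) (Ioo (-1) 1) P

section Estimator

variable {n p : ℕ} (Y : Fin n → Fin p → Bool)

/-- The proportion `P̂_j` of observations with `Y_j = 1`. -/
def probHat (j : Fin p) : ℝ :=
  (∑ i, if Y i j = true then (1 : ℝ) else 0) / n

/-- The proportion `P̂_{j₁ j₂}` of observations with `Y_{j₁} = Y_{j₂} = 1`. -/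
def prob₂Hat (j₁ j₂ : Fin p) : ℝ :=
  (∑ i, if Y i j₁ = true ∧ Y i j₂ = true then (1 : ℝ) else 0) / n

/-- `ĉ_j = -Φ⁻¹(P̂_j)`. -/
def cHat (j : Fin p) : ℝ :=
  -normalQuantile (probHat Y j)

/-- The moment estimator `Σ̂`, with unit diagonal and off-diagonal entries
`ℓ⁻¹(ĉ_{j₁}, ĉ_{j₂}; P̂_{j₁ j₂})`. -/
def SigmaHat : Matrix (Fin p) (Fin p) ℝ :=
  Matrix.of fun j₁ j₂ =>
    if j₁ = j₂ then 1 else ellInv (cHat Y j₁) (cHat Y j₂) (prob₂Hat Y j₁ j₂)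

end Estimator

end

/-! ### Eigenvector perturbation -/

section Perturbation

open Matrix

variable {p d : ℕ}

/-! The nonzero eigenvalues of `B Bᵀ` are at least `lam * p`, whereas `D` has entries bounded by 1
on the diagonal and none elsewhere. If `S` is entrywise within `η` of `Σ`, then `E = S - B Bᵀ` has
squared Frobenius norm at most `2 η² p² + 2 p`, hence at most `(2 η p)²` once `η² p ≥ 1`. Signal and
noise both scale like `p`, so a Davis–Kahan argument (`discrepancy_nonneg_and_le`) bounds the
discrepancy by a quantity that is free of `p` and vanishes with `η`
(`discrepancy_nonneg_and_le_of_entrywise`). Part (1) is the case `S = Σ`.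

For part (2) it remains to show that `Σ̂` is entrywise close to `Σ`, uniformly over all pairs. The
bivariate tail is strictly increasing in the correlation (`bivTail_strictMono`), so the moment
equations have a unique solution where they have one. Thresholds are bounded by (C1) and
correlations stay away from `±1` by (C3); compactness then makes the solution stable with a
tolerance `t` common to all models (`exists_abs_ellInv_sub_le`). Chebyshev's inequality and a union
bound over `p²` pairs show that some frequency misses its target by `t` with probability at most `p²
/ (n t²)`, which tends to 0 because `ξ < 1/2`. No rate is needed in the inversion step. -/

theorem dotProduct_self_nonneg_real {m : ℕ} (v : Fin m → ℝ) : 0 ≤ v ⬝ᵥ v :=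
  Finset.sum_nonneg fun _ _ => mul_self_nonneg _

theorem dotProduct_sq_le {m : ℕ} (v w : Fin m → ℝ) :
    (v ⬝ᵥ w) ^ 2 ≤ (v ⬝ᵥ v) * (w ⬝ᵥ w) := by
  simpa only [dotProduct, pow_two] using Finset.sum_mul_sq_le_sq_mul_sq Finset.univ v w

/-- The operator norm is at most the Frobenius norm. -/
theorem mulVec_dotProduct_self_le {l m : ℕ} (E : Matrix (Fin l) (Fin m) ℝ) (v : Fin m → ℝ) :
    E *ᵥ v ⬝ᵥ E *ᵥ v ≤ (∑ i, ∑ j, E i j ^ 2) * (v ⬝ᵥ v) := by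
  rw [Finset.sum_mul]
  refine Finset.sum_le_sum fun i _ => ?_
  have := dotProduct_sq_le (E i) v
  simpa only [mulVec, dotProduct, pow_two] using this

theorem neg_mul_le_dotProduct_mulVec (E : Matrix (Fin p) (Fin p) ℝ) {f : ℝ} (hf : 0 ≤ f)
    (hE : ∑ i, ∑ j, E i j ^ 2 ≤ f ^ 2) (v : Fin p → ℝ) :
    -(f * (v ⬝ᵥ v)) ≤ v ⬝ᵥ E *ᵥ v := by
  have h1 := dotProduct_sq_le v (E *ᵥ v)
  have h2 := mulVec_dotProduct_self_le E v
  have hv := dotProduct_self_nonneg_real v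
  refine (abs_le_of_sq_le_sq' ?_ (by positivity)).1
  calc (v ⬝ᵥ E *ᵥ v) ^ 2 ≤ (v ⬝ᵥ v) * (f ^ 2 * (v ⬝ᵥ v)) :=
        h1.trans (mul_le_mul_of_nonneg_left
          (h2.trans (mul_le_mul_of_nonneg_right hE hv)) hv)
    _ = (f * (v ⬝ᵥ v)) ^ 2 := by ring

/-- If a vector is orthogonal to the eigenvectors for the `k` largest eigenvalues, its Rayleigh
quotient is at most the next eigenvalue. -/
theorem dotProduct_mulVec_le_eigenvalues₀ {S : Matrix (Fin p) (Fin p) ℝ} (hS : S.IsHermitian)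
    (k : Fin (Fintype.card (Fin p))) (v : Fin p → ℝ)
    (hv : ∀ i < k, (hS.eigenvectorBasis
      (Fintype.equivOfCardEq (Fintype.card_fin _) i)).ofLp ⬝ᵥ v = 0) :
    v ⬝ᵥ S *ᵥ v ≤ hS.eigenvalues₀ k * (v ⬝ᵥ v) := by
  set u := hS.eigenvectorBasis
  have hin : ∀ x y : Fin p → ℝ, inner ℝ (WithLp.toLp 2 x) (WithLp.toLp 2 y) = x ⬝ᵥ y := by
    intro x y
    simp [PiLp.inner_apply, dotProduct, mul_comm]
  have hex : ∀ x y : Fin p → ℝ, ∑ j, ((u j).ofLp ⬝ᵥ x) * ((u j).ofLp ⬝ᵥ y) = x ⬝ᵥ y := by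
    intro x y
    rw [← hin, ← u.sum_inner_mul_inner]
    refine Finset.sum_congr rfl fun j _ => ?_
    rw [← hin, ← hin, real_inner_comm]
  have hsym : Sᵀ = S := by rw [← conjTranspose_eq_transpose_of_trivial, hS.eq]
  have hSu : ∀ j, (u j).ofLp ⬝ᵥ S *ᵥ v = hS.eigenvalues j * ((u j).ofLp ⬝ᵥ v) := by
    intro j
    rw [dotProduct_mulVec, ← mulVec_transpose, hsym, hS.mulVec_eigenvectorBasis, smul_dotProduct,
      smul_eq_mul]
  rw [← hex v (S *ᵥ v), ← hex v v, Finset.mul_sum]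
  refine Finset.sum_le_sum fun j _ => ?_
  rw [hSu]
  -- The ordering is known for `eigenvalues₀` only, so the index is pulled back to the sorted
  -- enumeration.
  obtain ⟨i, rfl⟩ := (Fintype.equivOfCardEq (Fintype.card_fin (Fintype.card (Fin p)))).surjective j
  rcases lt_or_ge i k with hik | hik
  · rw [hv i hik]; simp
  · have he : hS.eigenvalues (Fintype.equivOfCardEq (Fintype.card_fin _) i)
        = hS.eigenvalues₀ i := by
      simp [IsHermitian.eigenvalues]
    rw [he]
    have := hS.eigenvalues₀_antitone hik
    nlinarith [mul_le_mul_of_nonneg_right this (mul_self_nonneg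
      ((u (Fintype.equivOfCardEq (Fintype.card_fin _) i)).ofLp ⬝ᵥ v))]

/-- Weyl's inequality for a perturbation of `B Bᵀ`. -/
theorem le_eigenvalues₀_of_eq_add {S E : Matrix (Fin p) (Fin p) ℝ} {B : Matrix (Fin p) (Fin d) ℝ}
    (hS : S.IsHermitian) (hSE : S = B * Bᵀ + E) {a f : ℝ} (ha : 0 < a) (hf : 0 ≤ f)
    (hB : ∀ x, a * (x ⬝ᵥ x) ≤ B *ᵥ x ⬝ᵥ B *ᵥ x) (hE : ∑ i, ∑ j, E i j ^ 2 ≤ f ^ 2)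
    (k : Fin d) (hk : (k : ℕ) < Fintype.card (Fin p)) :
    a - f ≤ hS.eigenvalues₀ ⟨k, hk⟩ := by
  let u : Fin k → Fin p → ℝ := fun i => (hS.eigenvectorBasis
    (Fintype.equivOfCardEq (Fintype.card_fin _) ⟨i, i.2.trans hk⟩)).ofLp
  let L : (Fin d → ℝ) →ₗ[ℝ] (Fin k → ℝ) := (Matrix.of u * B).mulVecLin
  -- Dimension count: orthogonality of `B x` to the first `k` eigenvectors imposes `k < d` linear
  -- conditions on `x`.
  have hker : LinearMap.ker L ≠ ⊥ := LinearMap.ker_ne_bot_of_finrank_lt (by simp)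
  obtain ⟨x, hx, hx0⟩ := Submodule.exists_mem_ne_zero_of_ne_bot hker
  have hxk : ∀ i : Fin k, u i ⬝ᵥ B *ᵥ x = 0 := by
    intro i
    have := congrFun (LinearMap.mem_ker.1 hx) i
    simpa [L, ← mulVec_mulVec, mulVec] using this
  set v := B *ᵥ x with hvdef
  have hxx : 0 < x ⬝ᵥ x :=
    lt_of_le_of_ne (dotProduct_self_nonneg_real x) (fun h => hx0 (dotProduct_self_eq_zero.1 h.symm))
  have hvv : 0 < v ⬝ᵥ v := lt_of_lt_of_le (by positivity) (hB x)
  have hup := dotProduct_mulVec_le_eigenvalues₀ hS ⟨k, hk⟩ v fun i hi => hxk ⟨i, hi⟩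
  have hlow := neg_mul_le_dotProduct_mulVec E hf hE v
  -- The lower bound for `Bᵀ B` passes to `B Bᵀ` on the range of `B`: apply Cauchy–Schwarz to `v ⬝ᵥ
  -- v = x ⬝ᵥ Bᵀ v` and use `a (x ⬝ᵥ x) ≤ v ⬝ᵥ v`.
  have hBv : a * (v ⬝ᵥ v) ≤ Bᵀ *ᵥ v ⬝ᵥ Bᵀ *ᵥ v := by
    have e : v ⬝ᵥ v = x ⬝ᵥ Bᵀ *ᵥ v := by
      rw [dotProduct_mulVec, ← mulVec_transpose, dotProduct_comm]
    have h1 := dotProduct_sq_le x (Bᵀ *ᵥ v)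
    rw [← e] at h1
    have h2 := hB x
    have h3 := dotProduct_self_nonneg_real (Bᵀ *ᵥ v)
    have h4 : (a * (v ⬝ᵥ v)) * (v ⬝ᵥ v) ≤ (Bᵀ *ᵥ v ⬝ᵥ Bᵀ *ᵥ v) * (v ⬝ᵥ v) := by
      nlinarith [mul_le_mul_of_nonneg_right h2 h3]
    exact le_of_mul_le_mul_right h4 hvv
  have hsplit : v ⬝ᵥ S *ᵥ v = Bᵀ *ᵥ v ⬝ᵥ Bᵀ *ᵥ v + v ⬝ᵥ E *ᵥ v := by
    rw [hSE, add_mulVec, dotProduct_add, ← mulVec_mulVec, dotProduct_mulVec, ← mulVec_transpose]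
  refine le_of_mul_le_mul_right ?_ hvv
  linarith

theorem isSymm_projMatrix (A : Matrix (Fin p) (Fin d) ℝ) : (projMatrix A)ᵀ = projMatrix A := by
  simp [projMatrix, transpose_mul, transpose_nonsing_inv, Matrix.mul_assoc]

/-- A perturbation bound of Davis–Kahan type for the top eigenvectors of `B Bᵀ + E`. -/
theorem discrepancy_nonneg_and_le {S E : Matrix (Fin p) (Fin p) ℝ} {B V : Matrix (Fin p) (Fin d) ℝ}
    (hSE : S = B * Bᵀ + E) {a f : ℝ} (hf : 0 ≤ f) (haf : f < a)
    (hB : ∀ x, a * (x ⬝ᵥ x) ≤ B *ᵥ x ⬝ᵥ B *ᵥ x) (hE : ∑ i, ∑ j, E i j ^ 2 ≤ f ^ 2)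
    (hV : IsTopEigenvectors S V) :
    0 ≤ discrepancy B V ∧ discrepancy B V ≤ 2 * (d * (f ^ 2 / (a - f) ^ 2)) := by
  obtain ⟨hVV, hS, hk⟩ := hV
  have ha : 0 < a := hf.trans_lt haf
  -- The lower bound forces full column rank, so the inverse in `projMatrix B` is a genuine one.
  have hdet : IsUnit (Bᵀ * B) := by
    rw [← mulVec_injective_iff_isUnit]
    intro x y hxy
    have h0 : (Bᵀ * B) *ᵥ (x - y) = 0 := by rw [mulVec_sub]; exact sub_eq_zero.2 hxy
    have h1 := hB (x - y)
    have h2 : B *ᵥ (x - y) ⬝ᵥ B *ᵥ (x - y) = 0 := by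
      rw [dotProduct_mulVec, ← mulVec_transpose, mulVec_mulVec, h0, zero_dotProduct]
    have h3 := dotProduct_self_nonneg_real (x - y)
    have h4 : (x - y) ⬝ᵥ (x - y) = 0 := by nlinarith
    exact sub_eq_zero.1 (dotProduct_self_eq_zero.1 h4)
  have hdet' := (Matrix.isUnit_iff_isUnit_det _).1 hdet
  set H := projMatrix B with hH
  set Q := 1 - H with hQ
  have hHB : H * B = B := by
    rw [hH, projMatrix, Matrix.mul_assoc, Matrix.mul_assoc, Matrix.nonsing_inv_mul _ hdet',
      Matrix.mul_one]
  have hHH : H * H = H := by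
    conv_lhs => rw [hH, projMatrix, ← Matrix.mul_assoc, ← Matrix.mul_assoc, ← projMatrix, ← hH, hHB]
    rfl
  have hHt : Hᵀ = H := isSymm_projMatrix B
  have hQQ : Q * Q = Q := by
    rw [hQ, Matrix.sub_mul, Matrix.mul_sub, Matrix.mul_sub, hHH]; simp
  have hQt : Qᵀ = Q := by rw [hQ, transpose_sub, hHt, transpose_one]
  have hQB : Q * B = 0 := by rw [hQ, Matrix.sub_mul, hHB]; simp
  have hHV : projMatrix V = V * Vᵀ := by rw [projMatrix, hVV]; simp
  have htrH : H.trace = d := by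
    rw [hH, projMatrix, Matrix.mul_assoc, trace_mul_comm, Matrix.mul_assoc,
      Matrix.nonsing_inv_mul _ hdet', trace_one, Fintype.card_fin]
  have htrV : (V * Vᵀ).trace = d := by
    rw [trace_mul_comm, hVV, trace_one, Fintype.card_fin]
  -- Both projections have trace `d`, so the trace expands to `2 (d - tr (H V Vᵀ))`, twice the
  -- squared mass of the columns of `V` off the range of `B`.
  have hdisc : discrepancy B V = 2 * ∑ k, Q *ᵥ V.col k ⬝ᵥ Q *ᵥ V.col k := by
    have e1 : ∑ k, Q *ᵥ V.col k ⬝ᵥ Q *ᵥ V.col k = ((Q * V)ᵀ * (Q * V)).trace := by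
      rw [trace]
      refine Finset.sum_congr rfl fun k _ => ?_
      rw [diag_apply, mul_apply]
      simp only [dotProduct, transpose_apply, mul_apply, mulVec, Matrix.col]
    have e2 : ((Q * V)ᵀ * (Q * V)).trace = d - (H * (V * Vᵀ)).trace := by
      rw [transpose_mul, hQt, Matrix.mul_assoc, ← Matrix.mul_assoc Q, hQQ, trace_mul_comm,
        Matrix.mul_assoc, hQ, Matrix.sub_mul, Matrix.one_mul, trace_sub, htrV]
    have e3 : (V * Vᵀ) * (V * Vᵀ) = V * Vᵀ := by
      rw [Matrix.mul_assoc, ← Matrix.mul_assoc Vᵀ, hVV, Matrix.one_mul]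
    rw [e1, e2, discrepancy, hHV, pow_two, Matrix.sub_mul, Matrix.mul_sub, Matrix.mul_sub, e3,
      ← hH, hHH, trace_sub, trace_sub, trace_sub, htrH, htrV, trace_mul_comm (V * Vᵀ) H]
    ring
  have hcol : ∀ k, Q *ᵥ V.col k ⬝ᵥ Q *ᵥ V.col k ≤ f ^ 2 / (a - f) ^ 2 := by
    intro k
    obtain ⟨hkp, hev⟩ := hk k
    have hΛ := le_eigenvalues₀_of_eq_add hS hSE ha hf hB hE k hkp
    set Λ := hS.eigenvalues₀ ⟨k, hkp⟩
    set v := V.col k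
    have hvv : v ⬝ᵥ v = 1 := by
      have := congrFun (congrFun hVV k) k
      rw [mul_apply, one_apply_eq] at this
      simpa [dotProduct, transpose_apply, v, Matrix.col] using this
    -- Since `Q B = 0`, applying `Q` to the eigenvalue equation leaves only the noise; dividing by
    -- `Λ ≥ a - f` bounds `Q v`.
    have hkey : Λ • (Q *ᵥ v) = Q *ᵥ (E *ᵥ v) := by
      rw [← mulVec_smul, ← hev, hSE, add_mulVec, mulVec_add, mulVec_mulVec, ← Matrix.mul_assoc,
        hQB]
      simp
    have hcontr : ∀ w : Fin p → ℝ, Q *ᵥ w ⬝ᵥ Q *ᵥ w ≤ w ⬝ᵥ w := by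
      intro w
      have c1 : Q *ᵥ w ⬝ᵥ Q *ᵥ w = w ⬝ᵥ Q *ᵥ w := by
        rw [dotProduct_mulVec, ← mulVec_transpose, hQt, mulVec_mulVec, hQQ, dotProduct_comm]
      have c2 := dotProduct_sq_le w (Q *ᵥ w)
      have c3 := dotProduct_self_nonneg_real (Q *ᵥ w)
      have c4 := dotProduct_self_nonneg_real w
      rw [← c1] at c2
      by_contra! hlt
      nlinarith
    have h1 : Λ ^ 2 * (Q *ᵥ v ⬝ᵥ Q *ᵥ v) ≤ f ^ 2 := by
      calc Λ ^ 2 * (Q *ᵥ v ⬝ᵥ Q *ᵥ v) = Q *ᵥ (E *ᵥ v) ⬝ᵥ Q *ᵥ (E *ᵥ v) := by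
            rw [← hkey, smul_dotProduct, dotProduct_smul, smul_eq_mul, smul_eq_mul]; ring
        _ ≤ E *ᵥ v ⬝ᵥ E *ᵥ v := hcontr _
        _ ≤ _ := by simpa [hvv] using (mulVec_dotProduct_self_le E v).trans
                      (mul_le_mul_of_nonneg_right hE (dotProduct_self_nonneg_real v))
    have h2 : (a - f) ^ 2 ≤ Λ ^ 2 := pow_le_pow_left₀ (by linarith) hΛ 2
    rw [le_div_iff₀ (pow_pos (by linarith) 2)]
    nlinarith [dotProduct_self_nonneg_real (Q *ᵥ v)]
  rw [hdisc]
  refine ⟨mul_nonneg zero_le_two (Finset.sum_nonneg fun _ _ => dotProduct_self_nonneg_real _), ?_⟩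
  refine mul_le_mul_of_nonneg_left ?_ zero_le_two
  simpa using Finset.sum_le_sum fun k (_ : k ∈ Finset.univ) => hcol k

end Perturbation

/-! ### Gaussian tail probabilities -/

section GaussianTail

instance instNullSingletonClassStdGaussianReal : NullSingletonClass (gaussianReal 0 1) :=
  nullSingletonClass_gaussianReal one_ne_zero

/-- The upper tail probability of the standard normal distribution. -/
noncomputable def gaussTail (t : ℝ) : ℝ := (gaussianReal 0 1).real (Ioi t)

theorem gaussTail_nonneg (t : ℝ) : 0 ≤ gaussTail t := measureReal_nonneg

theorem gaussTail_le_one (t : ℝ) : gaussTail t ≤ 1 := measureReal_le_one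

theorem gaussTail_eq_cdf_neg (t : ℝ) : gaussTail t = cdf (gaussianReal 0 1) (-t) := by
  have h : (gaussianReal 0 1).map (fun x => -x) = gaussianReal 0 1 := by
    simp [gaussianReal_map_neg]
  rw [cdf_eq_real, gaussTail]
  conv_rhs => rw [← h, map_measureReal_apply measurable_neg measurableSet_Iic]
  have : (fun x : ℝ => -x) ⁻¹' Iic (-t) = Ici t := by ext; simp
  rw [this]
  exact measureReal_congr Ioi_ae_eq_Ici

/-- Dominated convergence: as a function of `t`, the indicator of `x > t` jumps at `t₀` only for `x
= t₀`, a null set. -/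
theorem continuous_gaussTail : Continuous gaussTail := by
  have h : gaussTail = fun t => ∫ x, (Ioi t).indicator (1 : ℝ → ℝ) x ∂gaussianReal 0 1 := by
    funext t
    rw [integral_indicator_one measurableSet_Ioi, gaussTail]
  rw [h, continuous_iff_continuousAt]
  intro t₀
  refine continuousAt_of_dominated (bound := fun _ => 1) (.of_forall fun t => ?_)
    (.of_forall fun t => .of_forall fun x => ?_) (integrable_const _) ?_
  · exact (measurable_one.indicator measurableSet_Ioi).aestronglyMeasurable
  · exact (norm_indicator_le_norm_self _ _).trans (by simp)
  · filter_upwards [compl_mem_ae_iff.2 (measure_singleton (μ := gaussianReal 0 1) t₀)] with x hx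
    rcases lt_or_gt_of_ne (show x ≠ t₀ from hx) with h | h
    · refine (continuousAt_const (y := (0 : ℝ))).congr ?_
      filter_upwards [eventually_gt_nhds h] with t ht
      exact (indicator_of_notMem (by simpa using ht.le) _).symm
    · refine (continuousAt_const (y := (1 : ℝ))).congr ?_
      filter_upwards [eventually_lt_nhds h] with t ht
      exact (indicator_of_mem (by simpa using ht) (1 : ℝ → ℝ)).symm

theorem gaussianReal_ne_zero_of_Ioo_subset {a b : ℝ} (hab : a < b) {s : Set ℝ}
    (hs : Ioo a b ⊆ s) : gaussianReal 0 1 s ≠ 0 := by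
  intro h
  have h0 := gaussianReal_absolutelyContinuous' 0 one_ne_zero (measure_mono_null hs h)
  rw [Real.volume_Ioo, ENNReal.ofReal_eq_zero] at h0
  linarith

theorem strictAnti_gaussTail : StrictAnti gaussTail := by
  intro a b hab
  have hdisj : Disjoint (Ioc a b) (Ioi b) :=
    Set.disjoint_left.2 fun x hx hx' => not_lt.2 hx.2 hx'
  have hpos : 0 < (gaussianReal 0 1).real (Ioc a b) :=
    ENNReal.toReal_pos (gaussianReal_ne_zero_of_Ioo_subset hab Ioo_subset_Ioc_self)
      (measure_ne_top _ _)
  rw [gaussTail, gaussTail, ← Ioc_union_Ioi_eq_Ioi hab.le,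
    measureReal_union hdisj measurableSet_Ioi]
  linarith

theorem tendsto_gaussTail_atTop : Tendsto gaussTail atTop (𝓝 0) := by
  rw [funext gaussTail_eq_cdf_neg]
  exact (tendsto_cdf_atBot _).comp tendsto_neg_atTop_atBot

theorem tendsto_gaussTail_atBot : Tendsto gaussTail atBot (𝓝 1) := by
  rw [funext gaussTail_eq_cdf_neg]
  exact (tendsto_cdf_atTop _).comp tendsto_neg_atBot_atTop

/-- Thus `c ↦ -normalQuantile` inverts the tail: on the range of the injective distribution
function, `invFun` is a true inverse. -/
theorem normalQuantile_gaussTail (t : ℝ) : normalQuantile (gaussTail t) = -t := by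
  rw [gaussTail_eq_cdf_neg, normalQuantile]
  refine Function.leftInverse_invFun (f := fun x => cdf (gaussianReal 0 1) x) (fun x y h => ?_) (-t)
  have : gaussTail (-x) = gaussTail (-y) := by simpa [gaussTail_eq_cdf_neg] using h
  exact neg_injective (strictAnti_gaussTail.injective this)

/-- `P(X > c₁, σ X + √(1 - σ²) W > c₂)` for independent standard normal `X` and `W`. -/
noncomputable def bivTail (c₁ c₂ σ : ℝ) : ℝ :=
  ∫ x in Ioi c₁, gaussTail ((c₂ - σ * x) / √(1 - σ ^ 2)) ∂gaussianReal 0 1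

theorem one_sub_sq_pos {σ : ℝ} (hσ : σ ∈ Ioo (-1 : ℝ) 1) : 0 < 1 - σ ^ 2 := by
  nlinarith [hσ.1, hσ.2]

theorem gaussianReal_map_affine (m s : ℝ) :
    (gaussianReal 0 1).map (fun w => m + s * w) = gaussianReal m (.mk (s ^ 2) (sq_nonneg s)) := by
  have h : (fun w => m + s * w) = (fun w => m + w) ∘ (fun w => s * w) := rfl
  rw [h, ← Measure.map_map (measurable_const_add m) (measurable_const_mul s),
    gaussianReal_map_const_mul, gaussianReal_map_const_add]
  simp

theorem integral_Ioi_gaussianPDFReal (m c : ℝ) {s : ℝ} (hs : 0 < s) :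
    ∫ y in Ioi c, gaussianPDFReal m (.mk (s ^ 2) (sq_nonneg s)) y = gaussTail ((c - m) / s) := by
  have hv : NNReal.mk (s ^ 2) (sq_nonneg s) ≠ 0 := by
    rw [← NNReal.coe_ne_zero]; exact (pow_pos hs 2).ne'
  have h1 := gaussianReal_apply_eq_integral m hv (Ioi c)
  rw [← gaussianReal_map_affine m s, Measure.map_apply (by fun_prop) measurableSet_Ioi] at h1
  have h2 : (fun w => m + s * w) ⁻¹' Ioi c = Ioi ((c - m) / s) := by
    ext w
    simp only [mem_preimage, mem_Ioi, div_lt_iff₀ hs]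
    constructor <;> intro h <;> linarith
  rw [h2] at h1
  rw [gaussTail, measureReal_def, h1, ENNReal.toReal_ofReal]
  exact setIntegral_nonneg measurableSet_Ioi fun _ _ => gaussianPDFReal_nonneg _ _ _

/-- Completing the square in `y` factors the bivariate density into the standard normal density of
`x` and the `N(σ x, 1 - σ²)` density of `y`; the inner integral is then a normal tail. -/
theorem ell_eq_bivTail (c₁ c₂ : ℝ) {σ : ℝ} (hσ : σ ∈ Ioo (-1 : ℝ) 1) :
    ell c₁ c₂ σ = bivTail c₁ c₂ σ := by
  have hpos := one_sub_sq_pos hσ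
  set s := √(1 - σ ^ 2) with hs
  have hs0 : 0 < s := Real.sqrt_pos.2 hpos
  have hs2 : s ^ 2 = 1 - σ ^ 2 := Real.sq_sqrt hpos.le
  have hpt : ∀ x y : ℝ, Real.exp (-((x ^ 2 + y ^ 2 - 2 * σ * x * y) / (2 * (1 - σ ^ 2))))
      = (2 * Real.pi * s) * gaussianPDFReal 0 1 x *
        gaussianPDFReal (σ * x) (.mk (s ^ 2) (sq_nonneg s)) y := by
    intro x y
    simp only [gaussianPDFReal, NNReal.coe_one, NNReal.coe_mk]
    have e1 : √(2 * Real.pi * s ^ 2) = √(2 * Real.pi) * s := by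
      rw [Real.sqrt_mul (by positivity), Real.sqrt_sq hs0.le]
    have e2 : -((x ^ 2 + y ^ 2 - 2 * σ * x * y) / (2 * (1 - σ ^ 2)))
        = -(x - 0) ^ 2 / (2 * 1) + -(y - σ * x) ^ 2 / (2 * s ^ 2) := by
      rw [hs2]; field_simp; ring
    have e3 : √(2 * Real.pi) * √(2 * Real.pi) = 2 * Real.pi := Real.mul_self_sqrt (by positivity)
    have e4 : √(2 * Real.pi) ≠ 0 := by positivity
    rw [e1, e2, Real.exp_add, mul_one]
    field_simp
    rw [pow_two, e3]
  rw [ell, bivTail, ← hs]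
  simp only [hpt, integral_const_mul, integral_Ioi_gaussianPDFReal _ _ hs0]
  rw [← integral_indicator measurableSet_Ioi, ← integral_indicator measurableSet_Ioi,
    integral_gaussianReal_eq_integral_smul one_ne_zero, ← integral_const_mul]
  refine integral_congr_ae (.of_forall fun x => ?_)
  by_cases hx : x ∈ Ioi c₁
  · simp only [indicator_of_mem hx, smul_eq_mul]
    have : Real.pi ≠ 0 := Real.pi_ne_zero
    field_simp
  · simp only [indicator_of_notMem hx, smul_zero, mul_zero]

theorem continuous_condTail (c₂ σ : ℝ) :
    Continuous fun x => gaussTail ((c₂ - σ * x) / √(1 - σ ^ 2)) :=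
  continuous_gaussTail.comp (by fun_prop)

theorem integrable_condTail (c₂ σ : ℝ) :
    Integrable (fun x => gaussTail ((c₂ - σ * x) / √(1 - σ ^ 2))) (gaussianReal 0 1) :=
  Integrable.of_bound (continuous_condTail c₂ σ).aestronglyMeasurable 1 <|
    .of_forall fun x => by
      rw [Real.norm_of_nonneg (gaussTail_nonneg _)]; exact gaussTail_le_one _

/-- Dominated convergence, with the threshold `x = c₁` as the only exceptional point; `|σ| < 1`
keeps the denominator away from zero. -/
theorem continuousAt_bivTail {q : ℝ × ℝ × ℝ} (hq : q.2.2 ∈ Ioo (-1 : ℝ) 1) :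
    ContinuousAt (fun q : ℝ × ℝ × ℝ => bivTail q.1 q.2.1 q.2.2) q := by
  have h : (fun q : ℝ × ℝ × ℝ => bivTail q.1 q.2.1 q.2.2) = fun q : ℝ × ℝ × ℝ =>
      ∫ x, (Ioi q.1).indicator
        (fun x => gaussTail ((q.2.1 - q.2.2 * x) / √(1 - q.2.2 ^ 2))) x ∂gaussianReal 0 1 := by
    funext q
    rw [integral_indicator measurableSet_Ioi, bivTail]
  rw [h]
  refine continuousAt_of_dominated (bound := fun _ => 1) (.of_forall fun r => ?_)
    (.of_forall fun r => .of_forall fun x => ?_) (integrable_const _) ?_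
  · exact ((continuous_condTail _ _).measurable.indicator measurableSet_Ioi).aestronglyMeasurable
  · refine (norm_indicator_le_norm_self _ _).trans ?_
    rw [Real.norm_of_nonneg (gaussTail_nonneg _)]; exact gaussTail_le_one _
  · filter_upwards [compl_mem_ae_iff.2 (measure_singleton (μ := gaussianReal 0 1) q.1)] with x hx
    have hfst : ContinuousAt (fun r : ℝ × ℝ × ℝ => r.1) q := continuousAt_fst
    rcases lt_or_gt_of_ne (show x ≠ q.1 from hx) with h | h
    · refine (continuousAt_const (y := (0 : ℝ))).congr ?_
      filter_upwards [hfst.eventually (eventually_gt_nhds h)] with r hr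
      exact (indicator_of_notMem (by simpa using hr.le) _).symm
    · have hs : √(1 - q.2.2 ^ 2) ≠ 0 := (Real.sqrt_pos.2 (one_sub_sq_pos hq)).ne'
      have hc : ContinuousAt
          (fun r : ℝ × ℝ × ℝ => gaussTail ((r.2.1 - r.2.2 * x) / √(1 - r.2.2 ^ 2))) q := by
        refine continuous_gaussTail.continuousAt.comp (ContinuousAt.div ?_ ?_ hs) <;> fun_prop
      refine hc.congr ?_
      filter_upwards [hfst.eventually (eventually_lt_nhds h)] with r hr
      rw [indicator_of_mem (by simpa using hr)]

/-- Fubini. The set `s` is general because a half-line gives the orthant probability and the whole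
line gives the marginal of the second coordinate. -/
theorem measureReal_prod_condTail (s : Set ℝ) (hs : MeasurableSet s) (c₂ : ℝ) {σ : ℝ}
    (hσ : σ ∈ Ioo (-1 : ℝ) 1) :
    ((gaussianReal 0 1).prod (gaussianReal 0 1)).real
        {z | z.1 ∈ s ∧ c₂ < σ * z.1 + √(1 - σ ^ 2) * z.2}
      = ∫ x in s, gaussTail ((c₂ - σ * x) / √(1 - σ ^ 2)) ∂gaussianReal 0 1 := by
  have hs0 : 0 < √(1 - σ ^ 2) := Real.sqrt_pos.2 (one_sub_sq_pos hσ)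
  have hm : MeasurableSet {z : ℝ × ℝ | z.1 ∈ s ∧ c₂ < σ * z.1 + √(1 - σ ^ 2) * z.2} :=
    (measurable_fst hs).inter (measurableSet_lt measurable_const
      (measurable_fst.const_mul σ |>.add (measurable_snd.const_mul _)))
  rw [measureReal_def, Measure.prod_apply hm, ← integral_toReal, ← integral_indicator hs]
  · refine integral_congr_ae (.of_forall fun x => ?_)
    by_cases hx : x ∈ s
    · simp only [indicator_of_mem hx, gaussTail, measureReal_def]
      congr 2
      ext w
      simp only [mem_preimage, mem_ofPred_eq, hx, true_and, mem_Ioi, div_lt_iff₀ hs0]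
      constructor <;> intro h <;> linarith
    · simp only [indicator_of_notMem hx]
      have : Prod.mk x ⁻¹' {z : ℝ × ℝ | z.1 ∈ s ∧ c₂ < σ * z.1 + √(1 - σ ^ 2) * z.2} = ∅ := by
        ext w; simp [hx]
      simp [this]
  · exact (measurable_measure_prodMk_left hm).aemeasurable
  · exact .of_forall fun x => measure_lt_top _ _

/-- `σ X + √(1 - σ²) W` is again standard normal, so the total integral does not depend on `σ`. This
allows `bivTail_strictMono` to pass to the complementary half-line. -/
theorem integral_condTail (c₂ : ℝ) {σ : ℝ} (hσ : σ ∈ Ioo (-1 : ℝ) 1) :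
    ∫ x, gaussTail ((c₂ - σ * x) / √(1 - σ ^ 2)) ∂gaussianReal 0 1 = gaussTail c₂ := by
  have h := measureReal_prod_condTail univ .univ c₂ hσ
  rw [setIntegral_univ] at h
  rw [← h]
  set γ := gaussianReal 0 1
  set P := γ.prod γ
  have hind : IndepFun (fun z : ℝ × ℝ => σ * z.1) (fun z : ℝ × ℝ => √(1 - σ ^ 2) * z.2) P :=
    indepFun_prod (measurable_const_mul σ) (measurable_const_mul _)
  have h1 : P.map (fun z => σ * z.1) = gaussianReal 0 (.mk (σ ^ 2) (sq_nonneg _)) := by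
    have : P.map (fun z => σ * z.1) = (P.map Prod.fst).map (σ * ·) :=
      (Measure.map_map (measurable_const_mul σ) measurable_fst).symm
    rw [this, Measure.map_fst_prod, measure_univ, one_smul, gaussianReal_map_const_mul]
    simp
  have h2 : P.map (fun z => √(1 - σ ^ 2) * z.2)
      = gaussianReal 0 (.mk (√(1 - σ ^ 2) ^ 2) (sq_nonneg _)) := by
    have : P.map (fun z => √(1 - σ ^ 2) * z.2) = (P.map Prod.snd).map (√(1 - σ ^ 2) * ·) :=
      (Measure.map_map (measurable_const_mul _) measurable_snd).symm
    rw [this, Measure.map_snd_prod, measure_univ, one_smul, gaussianReal_map_const_mul]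
    simp
  have h3 := gaussianReal_add_gaussianReal_of_indepFun hind h1 h2
  have hv : (.mk (σ ^ 2) (sq_nonneg _) + .mk (√(1 - σ ^ 2) ^ 2) (sq_nonneg _) : NNReal) = 1 := by
    rw [← NNReal.coe_inj]
    change σ ^ 2 + √(1 - σ ^ 2) ^ 2 = 1
    rw [Real.sq_sqrt (one_sub_sq_pos hσ).le]; ring
  rw [hv, add_zero] at h3
  rw [gaussTail, ← h3, map_measureReal_apply (by fun_prop) measurableSet_Ioi]
  congr 1
  ext z
  simp

/-- The ratio `σ / √(1 - σ²)` increases, so that the lines `x ↦ (c₂ - σ x) / √(1 - σ²)` for two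
values of `σ` cross exactly once. -/
theorem div_sqrt_one_sub_sq_lt {σ σ' : ℝ} (hσ : σ ∈ Ioo (-1 : ℝ) 1) (hσ' : σ' ∈ Ioo (-1 : ℝ) 1)
    (h : σ < σ') : σ / √(1 - σ ^ 2) < σ' / √(1 - σ' ^ 2) := by
  rw [← Real.tan_arcsin, ← Real.tan_arcsin]
  have hl := Real.neg_pi_div_two_lt_arcsin.2 hσ.1
  have hr := Real.arcsin_lt_pi_div_two.2 hσ'.2
  exact Real.tan_lt_tan_of_lt_of_lt_pi_div_two hl hr
    (Real.arcsin_lt_arcsin hσ.1.le h hσ'.2.le)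

theorem setIntegral_pos_of_pos_of_Ioo_subset {h : ℝ → ℝ} (hint : Integrable h (gaussianReal 0 1))
    {s : Set ℝ} (hs : MeasurableSet s) {a b : ℝ} (hab : a < b) (hsub : Ioo a b ⊆ s)
    (hnn : ∀ x ∈ s, 0 ≤ h x) (hpos : ∀ x ∈ Ioo a b, 0 < h x) :
    0 < ∫ x in s, h x ∂gaussianReal 0 1 := by
  rw [setIntegral_pos_iff_support_of_nonneg_ae ((ae_restrict_iff' hs).2 (.of_forall hnn))
    hint.integrableOn]
  refine pos_iff_ne_zero.2 (gaussianReal_ne_zero_of_Ioo_subset hab fun x hx => ⟨?_, hsub hx⟩)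
  exact (hpos x hx).ne'

/-- A single-crossing argument in place of differentiation in `σ`. The conditional tail for `σ'`
exceeds that for `σ` to the right of `x₀` and is below it to the left. If `x₀ ≤ c₁`, integration
over `x > c₁` suffices; otherwise the comparison over `x ≤ c₁` has the opposite sign and the equal
totals convert it. -/
theorem bivTail_strictMono (c₁ c₂ : ℝ) {σ σ' : ℝ} (hσ : σ ∈ Ioo (-1 : ℝ) 1)
    (hσ' : σ' ∈ Ioo (-1 : ℝ) 1) (hlt : σ < σ') : bivTail c₁ c₂ σ < bivTail c₁ c₂ σ' := by
  set s := √(1 - σ ^ 2) with hs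
  set s' := √(1 - σ' ^ 2) with hs'
  have hs0 : 0 < s := Real.sqrt_pos.2 (one_sub_sq_pos hσ)
  have hs0' : 0 < s' := Real.sqrt_pos.2 (one_sub_sq_pos hσ')
  set D := σ' / s' - σ / s with hD
  have hD0 : 0 < D := sub_pos.2 (div_sqrt_one_sub_sq_lt hσ hσ' hlt)
  set x₀ := c₂ * (1 / s' - 1 / s) / D with hx₀
  have hline : ∀ x, (c₂ - σ * x) / s - (c₂ - σ' * x) / s' = D * (x - x₀) := by
    intro x
    have : D * x₀ = c₂ * (1 / s' - 1 / s) := by rw [hx₀]; field_simp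
    rw [mul_sub, this, hD]
    field_simp
    ring
  set g := fun x => gaussTail ((c₂ - σ * x) / s)
  set g' := fun x => gaussTail ((c₂ - σ' * x) / s')
  have hg : Integrable g (gaussianReal 0 1) := integrable_condTail c₂ σ
  have hg' : Integrable g' (gaussianReal 0 1) := integrable_condTail c₂ σ'
  have hup : ∀ x, x₀ < x → g x < g' x := fun x hx =>
    strictAnti_gaussTail (by nlinarith [hline x, mul_pos hD0 (sub_pos.2 hx)])
  have hdown : ∀ x, x < x₀ → g' x < g x := fun x hx =>
    strictAnti_gaussTail (by nlinarith [hline x, mul_pos hD0 (sub_pos.2 hx)])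
  change ∫ x in Ioi c₁, g x ∂gaussianReal 0 1 < ∫ x in Ioi c₁, g' x ∂gaussianReal 0 1
  rcases le_or_gt x₀ c₁ with hc | hc
  · have := setIntegral_pos_of_pos_of_Ioo_subset (hg'.sub hg) measurableSet_Ioi
      (lt_add_one c₁) (fun x hx => hx.1)
      (fun x hx => (sub_pos.2 (hup x (hc.trans_lt hx))).le)
      (fun x hx => sub_pos.2 (hup x (hc.trans_lt hx.1)))
    simp only [Pi.sub_apply] at this
    rw [integral_sub hg'.integrableOn hg.integrableOn] at this
    linarith
  · have := setIntegral_pos_of_pos_of_Ioo_subset (hg.sub hg') measurableSet_Iic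
      (sub_one_lt c₁) (fun x hx => hx.2.le)
      (fun x hx => (sub_pos.2 (hdown x (lt_of_le_of_lt hx hc))).le)
      (fun x hx => sub_pos.2 (hdown x (hx.2.trans hc)))
    simp only [Pi.sub_apply] at this
    rw [integral_sub hg.integrableOn hg'.integrableOn] at this
    have e := integral_add_compl (measurableSet_Iic (a := c₁)) hg
    have e' := integral_add_compl (measurableSet_Iic (a := c₁)) hg'
    rw [compl_Iic, integral_condTail c₂ hσ] at e
    rw [compl_Iic, integral_condTail c₂ hσ'] at e'
    linarith

end GaussianTail

/-! ### Stability of the moment equations -/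

section Stability

/-- Over `|c| ≤ K` the tail changes by at least some `t > 0` when `c` moves by `±δ`. A value `q`
within `t` of the tail at `c` is therefore attained in `[c - δ, c + δ]`, so its quantile is not an
arbitrary default. -/
theorem exists_abs_neg_normalQuantile_sub_le (K : ℝ) {δ : ℝ} (hδ : 0 < δ) :
    ∃ t > 0, ∀ c q, |c| ≤ K → |q - gaussTail c| ≤ t → |-normalQuantile q - c| ≤ δ := by
  have hcont : Continuous fun c =>
      min (gaussTail (c - δ) - gaussTail c) (gaussTail c - gaussTail (c + δ)) := by
    have := continuous_gaussTail
    fun_prop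
  obtain ⟨t, ht, hgap⟩ := (isCompact_Icc (a := -K) (b := K)).exists_forall_le' hcont.continuousOn
    (a := 0) fun c _ => lt_min (sub_pos.2 (strictAnti_gaussTail (by linarith)))
      (sub_pos.2 (strictAnti_gaussTail (by linarith)))
  refine ⟨t, ht, fun c q hc hq => ?_⟩
  obtain ⟨h1, h2⟩ := le_min_iff.1 (hgap c (abs_le.1 hc))
  obtain ⟨h3, h4⟩ := abs_le.1 hq
  obtain ⟨y, hy, rfl⟩ := intermediate_value_Icc' (a := c - δ) (b := c + δ) (by linarith)
    continuous_gaussTail.continuousOn (show q ∈ Icc _ _ from ⟨by linarith, by linarith⟩)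
  rw [normalQuantile_gaussTail, neg_neg, abs_le]
  constructor <;> linarith [hy.1, hy.2]

theorem ellInv_bivTail (c₁ c₂ : ℝ) {σ : ℝ} (hσ : σ ∈ Ioo (-1 : ℝ) 1) :
    ellInv c₁ c₂ (bivTail c₁ c₂ σ) = σ := by
  have hinj : InjOn (ell c₁ c₂) (Ioo (-1) 1) := by
    refine StrictMonoOn.injOn fun x hx y hy hxy => ?_
    rw [ell_eq_bivTail _ _ hx, ell_eq_bivTail _ _ hy]
    exact bivTail_strictMono c₁ c₂ hx hy hxy
  rw [ellInv, ← ell_eq_bivTail _ _ hσ]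
  exact hinj.leftInvOn_invFunOn hσ

/-- The moment estimator of a correlation depends continuously on the observed frequencies,
uniformly for bounded thresholds and correlations bounded away from `±1`. -/
theorem exists_abs_ellInv_sub_le (K : ℝ) {s₀ ε : ℝ} (hs₀ : s₀ < 1) (hε : 0 < ε) :
    ∃ t > 0, ∀ c₁ c₂ σ q₁ q₂ q₁₂ : ℝ, |c₁| ≤ K → |c₂| ≤ K → |σ| ≤ s₀ →
      |q₁ - gaussTail c₁| ≤ t → |q₂ - gaussTail c₂| ≤ t → |q₁₂ - bivTail c₁ c₂ σ| ≤ t →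
      |ellInv (-normalQuantile q₁) (-normalQuantile q₂) q₁₂ - σ| ≤ ε := by
  -- The cap keeps `σ ± e` inside `(-1, 1)`, where `bivTail` is continuous and strictly increasing.
  set e := min ε ((1 - s₀) / 2) with he
  have he0 : 0 < e := lt_min hε (by linarith)
  have hes : e ≤ (1 - s₀) / 2 := min_le_right _ _
  have hmem : ∀ σ, |σ| ≤ s₀ + e → σ ∈ Ioo (-1 : ℝ) 1 := fun σ h =>
    abs_lt.1 (h.trans_lt (by linarith))
  have hshift : ∀ σ u, |σ| ≤ s₀ → |u| ≤ e → |σ + u| ≤ s₀ + e := fun σ u h1 h2 =>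
    (abs_add_le _ _).trans (add_le_add h1 h2)
  have hep : |e| ≤ e := (abs_of_pos he0).le
  have hen : |(-e)| ≤ e := by rw [abs_neg]; exact hep
  have hez : |(0 : ℝ)| ≤ e := by rw [abs_zero]; exact he0.le
  let f : ℝ × ℝ × ℝ → ℝ := fun q => bivTail q.1 q.2.1 q.2.2
  let C : Set (ℝ × ℝ × ℝ) := Icc (-K) K ×ˢ Icc (-K) K ×ˢ Icc (-s₀) s₀
  have hfc : ∀ q ∈ C, ∀ u, |u| ≤ e →
      ContinuousAt (fun q : ℝ × ℝ × ℝ => f (q.1, q.2.1, q.2.2 + u)) q := by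
    intro q hq u hu
    exact (continuousAt_bivTail (q := (q.1, q.2.1, q.2.2 + u))
      (hmem _ (hshift _ _ (abs_le.2 hq.2.2) hu))).comp
      (f := fun q : ℝ × ℝ × ℝ => (q.1, q.2.1, q.2.2 + u)) (by fun_prop)
  -- `m` is a uniform lower bound for the change of the tail when the correlation moves by `e`
  -- either way. The shift `+ 0` lets `hfc` serve all three terms.
  obtain ⟨m, hm, hgap⟩ : ∃ m, 0 < m ∧ ∀ q ∈ C,
      m ≤ min (f (q.1, q.2.1, q.2.2 + e) - f (q.1, q.2.1, q.2.2 + 0))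
        (f (q.1, q.2.1, q.2.2 + 0) - f (q.1, q.2.1, q.2.2 + -e)) := by
    refine (isCompact_Icc.prod (isCompact_Icc.prod isCompact_Icc)).exists_forall_le'
      (fun q hq => ContinuousAt.continuousWithinAt ?_) fun q hq => ?_
    · exact ((hfc q hq e hep).sub (hfc q hq 0 hez)).min ((hfc q hq 0 hez).sub (hfc q hq _ hen))
    · have hσ := abs_le.2 hq.2.2
      exact lt_min
        (sub_pos.2 (bivTail_strictMono _ _ (hmem _ (hshift _ _ hσ hez))
          (hmem _ (hshift _ _ hσ hep)) (by simpa using he0)))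
        (sub_pos.2 (bivTail_strictMono _ _ (hmem _ (hshift _ _ hσ hen))
          (hmem _ (hshift _ _ hσ hez)) (by simpa using he0)))
  -- The enlarged box also contains the estimated thresholds, which are off by at most 1; inside it,
  -- replacing the true thresholds costs less than `m / 2`.
  let C' : Set (ℝ × ℝ × ℝ) :=
    Icc (-(K + 1)) (K + 1) ×ˢ Icc (-(K + 1)) (K + 1) ×ˢ Icc (-(s₀ + e)) (s₀ + e)
  have huc : UniformContinuousOn f C' :=
    (isCompact_Icc.prod (isCompact_Icc.prod isCompact_Icc)).uniformContinuousOn_of_continuous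
      fun q hq => (continuousAt_bivTail (hmem _ (abs_le.2 hq.2.2))).continuousWithinAt
  obtain ⟨δ, hδ, hclose⟩ := Metric.uniformContinuousOn_iff.1 huc (m / 2) (by linarith)
  obtain ⟨t, ht, hquant⟩ := exists_abs_neg_normalQuantile_sub_le K
    (δ := min 1 (δ / 2)) (lt_min one_pos (by linarith))
  refine ⟨min t (m / 2), lt_min ht (by linarith), ?_⟩
  intro c₁ c₂ σ q₁ q₂ q₁₂ hc₁ hc₂ hσ hq₁ hq₂ hq₁₂
  have hd₁ := hquant c₁ q₁ hc₁ (hq₁.trans (min_le_left _ _))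
  have hd₂ := hquant c₂ q₂ hc₂ (hq₂.trans (min_le_left _ _))
  set b₁ := -normalQuantile q₁
  set b₂ := -normalQuantile q₂
  have hbd : ∀ c b : ℝ, |c| ≤ K → |b - c| ≤ min 1 (δ / 2) → |b| ≤ K + 1 := by
    intro c b h1 h2
    have := abs_add_le c (b - c)
    rw [add_sub_cancel] at this
    linarith [h2.trans (min_le_left _ _)]
  have hnear : ∀ u, |u| ≤ e → |f (b₁, b₂, σ + u) - f (c₁, c₂, σ + u)| < m / 2 := by
    intro u hu
    have hu' := abs_le.1 (hshift σ u hσ hu)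
    refine hclose (b₁, b₂, σ + u) ⟨abs_le.1 (hbd c₁ b₁ hc₁ hd₁), abs_le.1 (hbd c₂ b₂ hc₂ hd₂), hu'⟩
      (c₁, c₂, σ + u)
      ⟨abs_le.1 (by simpa using hc₁.trans (by linarith)),
        abs_le.1 (by simpa using hc₂.trans (by linarith)), hu'⟩ ?_
    have h1 := hd₁.trans (min_le_right _ _)
    have h2 := hd₂.trans (min_le_right _ _)
    simp only [Prod.dist_eq, dist_self, Real.dist_eq]
    exact max_lt (by linarith) (max_lt (by linarith) hδ)
  obtain ⟨hg1, hg2⟩ := le_min_iff.1 (hgap (c₁, c₂, σ) ⟨abs_le.1 hc₁, abs_le.1 hc₂, abs_le.1 hσ⟩)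
  simp only [add_zero] at hg1 hg2
  have h1 := abs_lt.1 (hnear e hep)
  have h2 := abs_lt.1 (hnear (-e) hen)
  have h3 := abs_le.1 (hq₁₂.trans (min_le_right _ _))
  have hq0 : f (c₁, c₂, σ) = bivTail c₁ c₂ σ := rfl
  have hIcc : ∀ x ∈ Icc (σ + -e) (σ + e), x ∈ Ioo (-1 : ℝ) 1 := fun x hx =>
    ⟨(hmem _ (hshift _ _ hσ hen)).1.trans_le hx.1, hx.2.trans_lt (hmem _ (hshift _ _ hσ hep)).2⟩
  -- Half of the gap `m` pays for the error in the thresholds and half for the error in `q₁₂`, so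
  -- `q₁₂` is still bracketed. A solution exists within `e` of `σ`, and by injectivity it is the
  -- value of `ellInv`.
  obtain ⟨x, hx, hxq⟩ := intermediate_value_Icc (a := σ + -e) (b := σ + e) (by linarith)
    (f := fun x => f (b₁, b₂, x)) (fun x hx => ContinuousAt.continuousWithinAt
      ((continuousAt_bivTail (q := (b₁, b₂, x)) (hIcc x hx)).comp
        (f := fun x : ℝ => (b₁, b₂, x)) (by fun_prop)))
    (show q₁₂ ∈ Icc _ _ from ⟨by linarith [h2.2, h3.1], by linarith [h1.1, h3.2]⟩)
  rw [← hxq]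
  change |ellInv b₁ b₂ (bivTail b₁ b₂ x) - σ| ≤ ε
  rw [ellInv_bivTail _ _ (hIcc x hx), abs_le]
  have := min_le_left ε ((1 - s₀) / 2)
  constructor <;> linarith [hx.1, hx.2]

end Stability

/-! ### Gaussian probabilities of orthants and their empirical frequencies -/

section Sampling

variable {Ω : Type*} [MeasurableSpace Ω] {μ : Measure Ω}

theorem measureReal_lt_eq_gaussTail {X : Ω → ℝ} (hX : HasGaussianLaw X μ) (hm : ∫ ω, X ω ∂μ = 0)
    (hv : Var[X; μ] = 1) (c : ℝ) : μ.real {ω | c < X ω} = gaussTail c := by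
  have h := hX.map_eq_gaussianReal
  rw [hm, hv, Real.toNNReal_one] at h
  rw [gaussTail, ← h, map_measureReal_apply_of_aemeasurable hX.aemeasurable measurableSet_Ioi]
  rfl

variable [IsProbabilityMeasure μ]

/-- The normalized residual `W` of the regression of `Y` on `X` is uncorrelated with `X` and jointly
Gaussian with it, hence an independent standard normal variable. -/
theorem measureReal_lt_and_lt_eq_bivTail {X Y : Ω → ℝ}
    (h : HasGaussianLaw (fun ω => (X ω, Y ω)) μ)
    (hX : ∫ ω, X ω ∂μ = 0) (hY : ∫ ω, Y ω ∂μ = 0) (hvX : Var[X; μ] = 1) (hvY : Var[Y; μ] = 1)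
    (hcov : cov[X, Y; μ] ∈ Ioo (-1 : ℝ) 1) (c₁ c₂ : ℝ) :
    μ.real {ω | c₁ < X ω ∧ c₂ < Y ω} = bivTail c₁ c₂ cov[X, Y; μ] := by
  set σ := cov[X, Y; μ] with hσ
  set s := √(1 - σ ^ 2) with hs
  have hpos := one_sub_sq_pos hcov
  have hs0 : 0 < s := Real.sqrt_pos.2 hpos
  have hs2 : s ^ 2 = 1 - σ ^ 2 := Real.sq_sqrt hpos.le
  have hX2 : MemLp X 2 μ := h.fst.memLp_two
  have hY2 : MemLp Y 2 μ := h.snd.memLp_two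
  let W : Ω → ℝ := fun ω => s⁻¹ * (Y ω - σ * X ω)
  have hXW : HasGaussianLaw (fun ω => (X ω, W ω)) μ :=
    h.map_fun ((ContinuousLinearMap.fst ℝ ℝ ℝ).prod
      (s⁻¹ • (ContinuousLinearMap.snd ℝ ℝ ℝ - σ • ContinuousLinearMap.fst ℝ ℝ ℝ)))
  have hσX2 : MemLp (fun ω => σ * X ω) 2 μ := hX2.const_mul σ
  have hcXW : cov[X, W; μ] = 0 := by
    rw [covariance_const_mul_right, covariance_fun_sub_right hX2 hY2 hσX2,
      covariance_const_mul_right, covariance_self h.fst.aemeasurable, hvX]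
    simp [hσ]
  have hmW : ∫ ω, W ω ∂μ = 0 := by
    rw [integral_const_mul, integral_sub (hY2.integrable one_le_two)
      (hσX2.integrable one_le_two), integral_const_mul, hX, hY]
    simp
  have hvW : Var[W; μ] = 1 := by
    rw [variance_const_mul, variance_fun_sub hY2 hσX2, variance_const_mul,
      covariance_const_mul_right, covariance_comm, hvX, hvY, ← hσ, inv_pow, hs2]
    field_simp
    ring
  have hind := hXW.indepFun_of_covariance_eq_zero hcXW
  have hlaw := (indepFun_iff_map_prod_eq_prod_map_map hXW.fst.aemeasurable
    hXW.snd.aemeasurable).1 hind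
  rw [hXW.fst.map_eq_gaussianReal, hXW.snd.map_eq_gaussianReal, hX, hvX, hmW, hvW,
    Real.toNNReal_one] at hlaw
  have hm : MeasurableSet {z : ℝ × ℝ | z.1 ∈ Ioi c₁ ∧ c₂ < σ * z.1 + s * z.2} :=
    (measurable_fst measurableSet_Ioi).inter (measurableSet_lt measurable_const
      (measurable_fst.const_mul σ |>.add (measurable_snd.const_mul _)))
  rw [bivTail, ← measureReal_prod_condTail (Ioi c₁) measurableSet_Ioi c₂ hcov, ← hlaw,
    map_measureReal_apply_of_aemeasurable hXW.aemeasurable hm]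
  congr 1
  ext ω
  have : σ * X ω + s * W ω = Y ω := by
    simp only [W]
    field_simp
    ring
  simp [this]

/-- Chebyshev's inequality for the relative frequency of an event. -/
theorem measure_le_abs_frequency_sub_le {E : Type*} [MeasurableSpace E] {n : ℕ} (hn : 0 < n)
    {X : Fin n → Ω → E} (hX : ∀ i, AEMeasurable (X i) μ) (hind : iIndepFun X μ)
    {A : Set E} (hA : MeasurableSet A) {q : ℝ} (hq : ∀ i, μ.real (X i ⁻¹' A) = q)
    {t : ℝ} (ht : 0 < t) :
    μ {ω | t ≤ |(∑ i, A.indicator (1 : E → ℝ) (X i ω)) / n - q|}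
      ≤ ENNReal.ofReal (1 / (n * t ^ 2)) := by
  have hf : Measurable (A.indicator (1 : E → ℝ)) := measurable_one.indicator hA
  let F : Fin n → Ω → ℝ := fun i ω => A.indicator (1 : E → ℝ) (X i ω)
  have hF01 : ∀ i ω, F i ω ∈ Icc (0 : ℝ) 1 := fun i ω =>
    ⟨indicator_nonneg (fun _ _ => zero_le_one) _, indicator_le_self' (fun _ _ => zero_le_one) _⟩
  have hFm : ∀ i, AEMeasurable (F i) μ := fun i => hf.comp_aemeasurable (hX i)
  have hF2 : ∀ i, MemLp (F i) 2 μ := fun i =>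
    MemLp.of_bound (hFm i).aestronglyMeasurable 1 <| .of_forall fun ω => by
      rw [Real.norm_of_nonneg (hF01 i ω).1]; exact (hF01 i ω).2
  have hFind : iIndepFun F μ := hind.comp (fun _ => A.indicator (1 : E → ℝ)) fun _ => hf
  have hFint : ∀ i, ∫ ω, F i ω ∂μ = q := by
    intro i
    have h1 := integral_map (hX i) (f := A.indicator (1 : E → ℝ)) hf.aestronglyMeasurable
    rw [integral_indicator_one hA, map_measureReal_apply_of_aemeasurable (hX i) hA, hq i] at h1
    exact h1.symm
  have hvar : Var[∑ i, F i; μ] ≤ n := by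
    rw [IndepFun.variance_sum (fun i _ => hF2 i) fun i _ j _ hij => hFind.indepFun hij]
    -- Values in `[0, 1]` give variance at most `1/4`; the cruder bound 1 suffices.
    calc ∑ i, Var[F i; μ] ≤ ∑ _i : Fin n, (1 : ℝ) := Finset.sum_le_sum fun i _ =>
          (variance_le_sq_of_bounded (.of_forall (hF01 i)) (hFm i)).trans (by norm_num)
      _ = n := by simp
  have hn' : (0 : ℝ) < n := Nat.cast_pos.2 hn
  have hsum : ∫ ω, (∑ i, F i) ω ∂μ = n * q := by
    simp only [Finset.sum_apply]
    rw [integral_finsetSum _ fun i _ => (hF2 i).integrable one_le_two]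
    simp [hFint]
  have hcheb := meas_ge_le_variance_div_sq (memLp_finsetSum' Finset.univ fun i _ => hF2 i)
    (c := n * t) (by positivity)
  rw [hsum] at hcheb
  refine (measure_mono fun ω hω => ?_).trans (hcheb.trans (ENNReal.ofReal_le_ofReal ?_))
  · change t ≤ |(∑ i, F i ω) / n - q| at hω
    change n * t ≤ |(∑ i, F i) ω - n * q|
    have : (∑ i, F i) ω - n * q = n * ((∑ i, F i ω) / n - q) := by
      rw [Finset.sum_apply]; field_simp
    rw [this, abs_mul, abs_of_pos hn']
    exact mul_le_mul_of_nonneg_left hω hn'.le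
  · rw [div_le_div_iff₀ (by positivity) (by positivity)]
    nlinarith [mul_le_mul_of_nonneg_right hvar (show 0 ≤ n * t ^ 2 by positivity)]

end Sampling

/-! ### The factor model -/

namespace ProbitFactorModel

open Matrix

variable {d p : ℕ} (M : ProbitFactorModel d p)

theorem Sigma_apply (j k : Fin p) :
    M.Sigma j k = ∑ l, M.B j l * M.B k l + if j = k then M.τ j ^ 2 else 0 := by
  simp [Sigma, Matrix.add_apply, mul_apply, diagonal_apply]

theorem Sigma_apply_self (j : Fin p) : M.Sigma j j = 1 := by
  rw [Sigma_apply, ← M.unit_variance j]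
  simp [pow_two]

theorem posSemidef_Sigma : M.Sigma.PosSemidef := by
  refine PosSemidef.add ?_ (PosSemidef.diagonal fun j => sq_nonneg _)
  simpa using posSemidef_self_mul_conjTranspose M.B

theorem prob_eq_gaussTail (j : Fin p) : M.prob j = gaussTail (M.c j) := by
  have h := (measurePreserving_eval_multivariateGaussian (μ := 0) M.posSemidef_Sigma
    (i := j)).measureReal_preimage (s := Ioi (M.c j)) measurableSet_Ioi.nullMeasurableSet
  rw [Sigma_apply_self, Real.toNNReal_one] at h
  exact h

/-- Unit variance gives `‖b_j‖² = 1 - τ_j² ≤ 1 - τmin²`, and Cauchy–Schwarz does the rest. This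
keeps the correlations in a fixed compact subset of `(-1, 1)`. -/
theorem abs_Sigma_le {τmin : ℝ} (hτmin : 0 < τmin) (hτ : ∀ j, τmin ≤ M.τ j) {j k : Fin p}
    (hjk : j ≠ k) : |M.Sigma j k| ≤ 1 - τmin ^ 2 := by
  have hrow : ∀ i, ∑ l, M.B i l ^ 2 ≤ 1 - τmin ^ 2 := fun i => by
    have := M.unit_variance i
    have := pow_le_pow_left₀ hτmin.le (hτ i) 2
    linarith
  have h0 : ∀ i, 0 ≤ ∑ l, M.B i l ^ 2 := fun i => Finset.sum_nonneg fun _ _ => sq_nonneg _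
  rw [Sigma_apply, if_neg hjk, add_zero]
  refine abs_le_of_sq_le_sq ?_ ((h0 j).trans (hrow j))
  calc (∑ l, M.B j l * M.B k l) ^ 2 ≤ (∑ l, M.B j l ^ 2) * ∑ l, M.B k l ^ 2 :=
        Finset.sum_mul_sq_le_sq_mul_sq _ _ _
    _ ≤ (1 - τmin ^ 2) * (1 - τmin ^ 2) :=
        mul_le_mul (hrow j) (hrow k) (h0 k) ((h0 j).trans (hrow j))
    _ = _ := (pow_two _).symm

theorem mul_dotProduct_le_of_loadings (hp : 0 < p) {lam : ℝ}
    (h : (M.SigmaB - lam • (1 : Matrix (Fin d) (Fin d) ℝ)).PosSemidef) (x : Fin d → ℝ) :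
    lam * p * (x ⬝ᵥ x) ≤ M.B *ᵥ x ⬝ᵥ M.B *ᵥ x := by
  have h1 := h.dotProduct_mulVec_nonneg x
  have h2 : x ⬝ᵥ M.SigmaB *ᵥ x = (p : ℝ)⁻¹ * (M.B *ᵥ x ⬝ᵥ M.B *ᵥ x) := by
    rw [SigmaB, smul_mulVec, dotProduct_smul, smul_eq_mul, ← mulVec_mulVec, dotProduct_mulVec,
      vecMul_transpose]
  rw [star_trivial, sub_mulVec, dotProduct_sub, smul_mulVec, one_mulVec, dotProduct_smul,
    smul_eq_mul, h2] at h1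
  have hp' : (0 : ℝ) < p := Nat.cast_pos.2 hp
  have h3 := mul_le_mul_of_nonneg_left (sub_nonneg.1 h1) hp'.le
  rw [← mul_assoc, mul_inv_cancel_left₀ hp'.ne'] at h3
  linarith

/-- A matrix that is entrywise close to `Σ` has its top eigenvectors close to the loadings. -/
theorem discrepancy_nonneg_and_le_of_entrywise {lam η : ℝ}
    (h : (M.SigmaB - lam • (1 : Matrix (Fin d) (Fin d) ℝ)).PosSemidef)
    (hη : 0 < η) (hηlam : 2 * η < lam) (hp : 1 ≤ η ^ 2 * p) {S : Matrix (Fin p) (Fin p) ℝ}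
    (hS : ∀ j k, |S j k - M.Sigma j k| ≤ η) {V : Matrix (Fin p) (Fin d) ℝ}
    (hV : IsTopEigenvectors S V) :
    0 ≤ discrepancy M.B V ∧
      discrepancy M.B V ≤ 2 * (d * ((2 * η) ^ 2 / (lam - 2 * η) ^ 2)) := by
  have hp0 : 0 < p := Nat.pos_of_ne_zero fun h0 => by
    rw [h0, Nat.cast_zero, mul_zero] at hp; linarith
  have hp' : (0 : ℝ) < p := Nat.cast_pos.2 hp0
  set E := S - M.B * M.Bᵀ with hE
  have hτ1 : ∀ j, M.τ j ^ 2 ≤ 1 := fun j => by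
    have := M.unit_variance j
    have : 0 ≤ ∑ l, M.B j l ^ 2 := Finset.sum_nonneg fun _ _ => sq_nonneg _
    linarith
  -- Split `E = (S - Σ) + D` and use `(x + y)² ≤ 2 x² + 2 y²` with `τ_j⁴ ≤ 1`.
  have hEjk : ∀ j k, E j k ^ 2 ≤ 2 * η ^ 2 + if j = k then 2 else 0 := by
    intro j k
    have e : E j k = (S j k - M.Sigma j k) + if j = k then M.τ j ^ 2 else 0 := by
      rw [Sigma_apply, hE, Matrix.sub_apply, mul_apply]
      simp only [transpose_apply]
      ring
    have h1 := sq_le_sq' (abs_le.1 (hS j k)).1 (abs_le.1 (hS j k)).2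
    rw [e]
    refine add_sq_le.trans ?_
    split_ifs with hjk
    · have := pow_le_one₀ (n := 2) (sq_nonneg (M.τ j)) (hτ1 j)
      linarith
    · simpa using h1
  have hEsum : ∑ j, ∑ k, E j k ^ 2 ≤ (2 * η * p) ^ 2 := by
    calc ∑ j, ∑ k, E j k ^ 2 ≤ ∑ j : Fin p, ∑ k, (2 * η ^ 2 + if j = k then (2 : ℝ) else 0) :=
          Finset.sum_le_sum fun j _ => Finset.sum_le_sum fun k _ => hEjk j k
      _ = 2 * η ^ 2 * p ^ 2 + 2 * p := by
          simp only [Finset.sum_add_distrib, Finset.sum_const, Finset.sum_ite_eq,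
            Finset.mem_univ, if_true, Finset.card_univ, Fintype.card_fin, nsmul_eq_mul]
          ring
      _ ≤ (2 * η * p) ^ 2 := by nlinarith [mul_le_mul_of_nonneg_right hp hp'.le]
  have key := discrepancy_nonneg_and_le (S := S) (E := E) (B := M.B) (V := V) (a := lam * p)
    (f := 2 * η * p) (by rw [hE]; abel) (by positivity) (by nlinarith)
    (M.mul_dotProduct_le_of_loadings hp0 h) hEsum hV
  -- The factor `p` cancels, which makes the bound uniform in the dimension.
  have e : (2 * η * p) ^ 2 / (lam * p - 2 * η * p) ^ 2 = (2 * η) ^ 2 / (lam - 2 * η) ^ 2 := by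
    rw [← sub_mul, mul_pow, mul_pow (lam - 2 * η)]
    exact mul_div_mul_right _ _ (pow_ne_zero 2 hp'.ne')
  rwa [e] at key

/-! ### Samples from the model -/

variable {Ω : Type*} [MeasurableSpace Ω] {μ : Measure Ω} [IsProbabilityMeasure μ] {n : ℕ}
  {M} {Z : Fin n → Ω → Fin d → ℝ} {ε : Fin n → Ω → Fin p → ℝ}

/-- By bilinearity, only second moments of the factors and errors enter; Gaussianity is needed for
their combination `e_i` alone. -/
theorem IsSample.cov_latent (h : M.IsSample μ Z ε) (i : Fin n) (j k : Fin p) :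
    cov[fun ω => M.latent (Z i) (ε i) ω j, fun ω => M.latent (Z i) (ε i) ω k; μ]
      = M.Sigma j k := by
  have hZ : ∀ j l, MemLp (fun ω => M.B j l * Z i ω l) 2 μ := fun j l =>
    (h.memLp_factor i l).const_mul _
  have hBZ : ∀ j, MemLp (fun ω => ∑ l, M.B j l * Z i ω l) 2 μ := fun j =>
    memLp_finsetSum _ fun l _ => hZ j l
  have hlat : ∀ j, (fun ω => M.latent (Z i) (ε i) ω j)
      = (fun ω => ∑ l, M.B j l * Z i ω l) + fun ω => ε i ω j := fun j => rfl
  have hcross : ∀ j k, cov[fun ω => ∑ l, M.B j l * Z i ω l, fun ω => ε i ω k; μ] = 0 := by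
    intro j k
    rw [covariance_fun_sum_left (hZ j) (h.memLp_error i k)]
    simp [covariance_const_mul_left, h.cov_factor_error]
  rw [hlat j, hlat k, covariance_add_left (hBZ j) (h.memLp_error i j)
    ((hBZ k).add (h.memLp_error i k)), covariance_add_right (hBZ j) (hBZ k) (h.memLp_error i k),
    covariance_add_right (h.memLp_error i j) (hBZ k) (h.memLp_error i k), hcross j k,
    covariance_comm, covariance_comm (fun ω => ε i ω j) (fun ω => ∑ l, M.B k l * Z i ω l),
    hcross k j, h.cov_error,
    covariance_fun_sum_fun_sum (hZ k) (hZ j), Sigma_apply]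
  simp only [covariance_const_mul_left, covariance_const_mul_right, h.cov_factor]
  simp [mul_comm]

theorem IsSample.variance_latent (h : M.IsSample μ Z ε) (i : Fin n) (j : Fin p) :
    Var[fun ω => M.latent (Z i) (ε i) ω j; μ] = 1 := by
  rw [← covariance_self ((h.gaussian_latent i).eval j).aemeasurable, h.cov_latent,
    Sigma_apply_self]

variable (M) in
/-- The probability that the features `j` and `k` of an observation are both positive. -/
noncomputable def orthantProb (j k : Fin p) : ℝ :=
  if j = k then gaussTail (M.c j) else bivTail (M.c j) (M.c k) (M.Sigma j k)

theorem IsSample.measureReal_latent (h : M.IsSample μ Z ε)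
    (hσ : ∀ j k, j ≠ k → M.Sigma j k ∈ Ioo (-1 : ℝ) 1) (i : Fin n) (j k : Fin p) :
    μ.real (M.latent (Z i) (ε i) ⁻¹' {x | M.c j < x j ∧ M.c k < x k}) = M.orthantProb j k := by
  rw [orthantProb]
  split_ifs with hjk
  · subst hjk
    rw [← measureReal_lt_eq_gaussTail ((h.gaussian_latent i).eval j) (h.mean_latent i j)
      (h.variance_latent i j) (M.c j)]
    simp
  · have hc := h.cov_latent i j k
    rw [← hc]
    exact measureReal_lt_and_lt_eq_bivTail ((h.gaussian_latent i).prodMk j k) (h.mean_latent i j)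
      (h.mean_latent i k) (h.variance_latent i j) (h.variance_latent i k)
      (hc ▸ hσ j k hjk) _ _

/-- Diagonal pairs carry the univariate frequencies, so a single union bound over pairs controls
both kinds of frequency. -/
theorem prob₂Hat_self {n p : ℕ} (Y : Fin n → Fin p → Bool) (j : Fin p) :
    prob₂Hat Y j j = probHat Y j := by
  simp [prob₂Hat, probHat]

/-- Chebyshev's inequality for each of the `p²` ordered pairs, summed. Independence between features
is not involved. -/
theorem IsSample.measure_le_abs_prob₂Hat_sub_le (h : M.IsSample μ Z ε) (hn : 0 < n)
    (hσ : ∀ j k, j ≠ k → M.Sigma j k ∈ Ioo (-1 : ℝ) 1) {t : ℝ} (ht : 0 < t) :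
    μ {ω | ∃ j k,
      t ≤ |prob₂Hat (fun i => M.binary (Z i) (ε i) ω) j k - M.orthantProb j k|}
      ≤ ENNReal.ofReal ((p : ℝ) ^ 2 / (n * t ^ 2)) := by
  have hA : ∀ j k, MeasurableSet {x : Fin p → ℝ | M.c j < x j ∧ M.c k < x k} := fun j k =>
    (measurableSet_lt measurable_const (measurable_pi_apply j)).inter
      (measurableSet_lt measurable_const (measurable_pi_apply k))
  have hone : ∀ j k, μ {ω | t ≤ |prob₂Hat (fun i => M.binary (Z i) (ε i) ω) j k
      - M.orthantProb j k|} ≤ ENNReal.ofReal (1 / (n * t ^ 2)) := by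
    intro j k
    have := measure_le_abs_frequency_sub_le hn (fun i => (h.gaussian_latent i).aemeasurable)
      h.indep_latent (hA j k) (h.measureReal_latent hσ · j k) ht
    refine (measure_mono fun ω hω => ?_).trans this
    change t ≤ _ at hω
    change t ≤ _
    convert hω using 4
    rw [prob₂Hat]
    congr 1
    refine Finset.sum_congr rfl fun i _ => ?_
    simp [indicator_apply, binary]
  have hset : {ω | ∃ j k, t ≤ |prob₂Hat (fun i => M.binary (Z i) (ε i) ω) j k
      - M.orthantProb j k|} = ⋃ j, ⋃ k, {ω | t ≤ |prob₂Hat (fun i => M.binary (Z i) (ε i) ω) j k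
      - M.orthantProb j k|} := by
    ext ω; simp
  rw [hset]
  calc _ ≤ ∑ j : Fin p, ∑ k : Fin p, ENNReal.ofReal (1 / (n * t ^ 2)) :=
        (measure_iUnion_fintype_le _ _).trans (Finset.sum_le_sum fun j _ =>
          (measure_iUnion_fintype_le _ _).trans (Finset.sum_le_sum fun k _ => hone j k))
    _ = ENNReal.ofReal ((p : ℝ) ^ 2 / (n * t ^ 2)) := by
        rw [div_eq_mul_one_div ((p : ℝ) ^ 2), ENNReal.ofReal_mul (by positivity),
          ENNReal.ofReal_pow (by positivity), ENNReal.ofReal_natCast]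
        simp [pow_two, mul_assoc]

theorem abs_SigmaHat_sub_Sigma_le {Y : Fin n → Fin p → Bool} {η t : ℝ} (hη : 0 < η)
    (hinv : ∀ j k, j ≠ k → |probHat Y j - gaussTail (M.c j)| ≤ t →
      |probHat Y k - gaussTail (M.c k)| ≤ t →
      |prob₂Hat Y j k - bivTail (M.c j) (M.c k) (M.Sigma j k)| ≤ t →
      |ellInv (cHat Y j) (cHat Y k) (prob₂Hat Y j k) - M.Sigma j k| ≤ η)
    (hY : ∀ j k, |prob₂Hat Y j k - M.orthantProb j k| ≤ t) (j k : Fin p) :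
    |SigmaHat Y j k - M.Sigma j k| ≤ η := by
  by_cases hjk : j = k
  · subst hjk
    simpa [SigmaHat, Sigma_apply_self] using hη.le
  · have hself : ∀ i, |probHat Y i - gaussTail (M.c i)| ≤ t := fun i => by
      simpa [orthantProb, prob₂Hat_self] using hY i i
    have := hinv j k hjk (hself j) (hself k) (by simpa [orthantProb, hjk] using hY j k)
    simpa [SigmaHat, hjk] using this

end ProbitFactorModel

/-! ### Choice of constants, growth of the dimension, and the main theorem -/

theorem exists_abs_le_of_gaussTail_mem {a b : ℝ} (ha : 0 < a) (hb : b < 1) :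
    ∃ K, ∀ c, a ≤ gaussTail c → gaussTail c ≤ b → |c| ≤ K := by
  obtain ⟨u, hu⟩ := (tendsto_gaussTail_atTop.eventually (gt_mem_nhds ha)).exists
  obtain ⟨v, hv⟩ := (tendsto_gaussTail_atBot.eventually (lt_mem_nhds hb)).exists
  refine ⟨max |u| |v|, fun c hca hcb => abs_le.2 ⟨?_, ?_⟩⟩
  · have : v < c := strictAnti_gaussTail.lt_iff_gt.1 (hcb.trans_lt hv)
    linarith [neg_abs_le v, le_max_right |u| |v|]
  · have : c < u := strictAnti_gaussTail.lt_iff_gt.1 (hu.trans_le hca)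
    linarith [le_abs_self u, le_max_left |u| |v|]

/-- The bound is continuous in `η` at 0 and vanishes there, because its denominator tends to `lam² >
0`. -/
theorem exists_pos_two_mul_lt_and_bound_lt (d : ℕ) {lam δ : ℝ} (hlam : 0 < lam) (hδ : 0 < δ) :
    ∃ η > 0, 2 * η < lam ∧ 2 * (d * ((2 * η) ^ 2 / (lam - 2 * η) ^ 2)) < δ := by
  have hc : ContinuousAt (fun η : ℝ => 2 * ((d : ℝ) * ((2 * η) ^ 2 / (lam - 2 * η) ^ 2))) 0 := by
    refine continuousAt_const.mul (continuousAt_const.mul (ContinuousAt.div ?_ ?_ ?_))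
    · fun_prop
    · fun_prop
    · simpa using hlam.ne'
  have h1 := hc.eventually (gt_mem_nhds (show _ < δ by simpa using hδ))
  have h2 : ∀ᶠ η : ℝ in 𝓝 0, 2 * η < lam :=
    (continuousAt_const.mul continuousAt_id).eventually (gt_mem_nhds (by simpa using hlam))
  obtain ⟨η, h, hη⟩ := (((h2.and h1).filter_mono nhdsWithin_le_nhds).and
    (self_mem_nhdsWithin (a := (0 : ℝ)) (s := Ioi 0))).exists
  exact ⟨η, hη, h⟩

/-- `(n ^ ξ)² / n = n ^ (-(1 - 2 ξ))`, a negative power precisely when `ξ < 1/2`. -/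
theorem tendsto_sq_div_mul_of_le_rpow {ξ ρ t : ℝ} (hξ : ξ < 1 / 2) (ht : 0 < t)
    {p : ℕ → ℕ} (hp : ∀ᶠ n : ℕ in atTop, (p n : ℝ) ≤ ρ * (n : ℝ) ^ ξ) :
    Tendsto (fun n : ℕ => (p n : ℝ) ^ 2 / (n * t ^ 2)) atTop (𝓝 0) := by
  have hlim : Tendsto (fun n : ℕ => ρ ^ 2 / t ^ 2 * (n : ℝ) ^ (-(1 - 2 * ξ))) atTop (𝓝 0) := by
    simpa using ((tendsto_rpow_neg_atTop (show 0 < 1 - 2 * ξ by linarith)).comp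
      tendsto_natCast_atTop_atTop).const_mul (ρ ^ 2 / t ^ 2)
  refine squeeze_zero' (.of_forall fun n => by positivity) ?_ hlim
  filter_upwards [hp, eventually_gt_atTop 0] with n hn hn0
  have hn' : (0 : ℝ) < n := Nat.cast_pos.2 hn0
  have e : (n : ℝ) ^ (-(1 - 2 * ξ)) = ((n : ℝ) ^ ξ) ^ 2 / n := by
    rw [show -(1 - 2 * ξ) = ξ * 2 - 1 by ring, Real.rpow_sub hn', Real.rpow_one,
      Real.rpow_mul hn'.le, Real.rpow_two]
  rw [e, div_mul_div_comm, ← mul_pow, mul_comm (n : ℝ)]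
  gcongr

theorem theorem2 (d : ℕ)
    (P₁min P₁max P₂min P₂max τmin τmax lam : ℝ)
    (hP₁min : 0 < P₁min) (hP₁ : P₁min ≤ P₁max) (hP₁max : P₁max < 1)
    (hP₂min : 0 < P₂min) (hP₂ : P₂min ≤ P₂max) (hP₂max : P₂max < 1)
    (hτmin : 0 < τmin) (hτ : τmin ≤ τmax) (hτmax : τmax < 1)
    (hlam : 0 < lam) :
    -- (1) asymptotic identifiability, as `p → ∞`
    (∀ (M : (p : ℕ) → ProbitFactorModel d p) (V : (p : ℕ) → Matrix (Fin p) (Fin d) ℝ),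
      (∀ᶠ p in atTop, (M p).Regular P₁min P₁max P₂min P₂max τmin τmax lam) →
      (∀ᶠ p in atTop, IsTopEigenvectors (M p).Sigma (V p)) →
      Tendsto (fun p => discrepancy (M p).B (V p)) atTop (𝓝 0)) ∧
    -- (2) consistency, as `n → ∞`, with `p = p n` features and `n` observations
    (∀ (ξ ρ : ℝ), 0 < ξ → ξ < 1 / 2 → 0 < ρ →
      ∀ (p : ℕ → ℕ), Tendsto p atTop atTop →
      (∀ᶠ n : ℕ in atTop, (p n : ℝ) ≤ ρ * (n : ℝ) ^ ξ) →
      ∀ (M : (n : ℕ) → ProbitFactorModel d (p n)),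
      (∀ᶠ n in atTop, (M n).Regular P₁min P₁max P₂min P₂max τmin τmax lam) →
      ∀ (Ω : Type*) [MeasurableSpace Ω] (μ : Measure Ω) [IsProbabilityMeasure μ]
        (Z : (n : ℕ) → Fin n → Ω → Fin d → ℝ) (ε : (n : ℕ) → Fin n → Ω → Fin (p n) → ℝ)
        (V : (n : ℕ) → Ω → Matrix (Fin (p n)) (Fin d) ℝ),
      (∀ᶠ n in atTop, (M n).IsSample μ (Z n) (ε n)) →
      (∀ᶠ n in atTop, ∀ ω, IsTopEigenvectors
        (SigmaHat (fun i => (M n).binary (Z n i) (ε n i) ω)) (V n ω)) →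
      TendstoInMeasure μ (fun n ω => discrepancy (M n).B (V n ω)) atTop (fun _ => 0)) := by
  have hlarge : ∀ η : ℝ, 0 < η → ∀ᶠ p : ℕ in atTop, 1 ≤ η ^ 2 * p := fun η hη =>
    (tendsto_natCast_atTop_atTop.const_mul_atTop (pow_pos hη 2)).eventually_ge_atTop 1
  constructor
  · intro M V hM hV
    rw [Metric.tendsto_nhds]
    intro δ hδ
    obtain ⟨η, hη, hηlam, hbound⟩ := exists_pos_two_mul_lt_and_bound_lt d hlam hδ
    filter_upwards [hM, hV, hlarge η hη] with p hMp hVp hp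
    obtain ⟨h1, h2⟩ := (M p).discrepancy_nonneg_and_le_of_entrywise hMp.loadings hη hηlam hp (fun j k => by simpa using hη.le) hVp
    rw [dist_zero_right, Real.norm_of_nonneg h1]
    exact h2.trans_lt hbound
  · intro ξ ρ _ hξ _ p hp hpn M hM Ω _ μ _ Z ε V hZ hV
    rw [tendstoInMeasure_iff_norm]
    intro δ hδ
    obtain ⟨η, hη, hηlam, hbound⟩ := exists_pos_two_mul_lt_and_bound_lt d hlam hδ
    obtain ⟨K, hK⟩ := exists_abs_le_of_gaussTail_mem hP₁min hP₁max
    have hs₀ : 1 - τmin ^ 2 < 1 := by linarith [pow_pos hτmin 2]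
    -- `t` depends on `K`, `τmin` and `η` only, so it is fixed before `n` varies.
    obtain ⟨t, ht, hstab⟩ := exists_abs_ellInv_sub_le K hs₀ hη
    have hlim := ENNReal.tendsto_ofReal (tendsto_sq_div_mul_of_le_rpow hξ ht hpn)
    rw [ENNReal.ofReal_zero] at hlim
    refine tendsto_of_tendsto_of_tendsto_of_le_of_le' tendsto_const_nhds hlim
      (.of_forall fun _ => zero_le) ?_
    filter_upwards [hM, hZ, hV, hp.eventually (hlarge η hη), eventually_gt_atTop 0]
      with n hMn hZn hVn hpn1 hn
    have hσ : ∀ j k, j ≠ k → |(M n).Sigma j k| ≤ 1 - τmin ^ 2 := fun j k hjk =>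
      (M n).abs_Sigma_le hτmin (fun j => (hMn.errors j).1) hjk
    have hc : ∀ j, |(M n).c j| ≤ K := fun j => by
      have := hMn.univariate j
      rw [ProbitFactorModel.prob_eq_gaussTail] at this
      exact hK _ this.1 this.2
    -- A discrepancy of at least `δ` forces some frequency to miss its target by `t`. Only an
    -- inclusion of sets is used, so `V n` may depend on `ω` in a nonmeasurable way.
    refine (measure_mono fun ω hω => ?_).trans (hZn.measure_le_abs_prob₂Hat_sub_le hn
      (fun j k hjk => abs_lt.1 ((hσ j k hjk).trans_lt hs₀)) ht)
    by_contra hcon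
    simp only [mem_ofPred_eq, not_exists, not_le] at hcon
    have hclose := ProbitFactorModel.abs_SigmaHat_sub_Sigma_le hη
      (fun j k hjk h1 h2 h3 => hstab _ _ _ _ _ _ (hc j) (hc k) (hσ j k hjk) h1 h2 h3)
      (fun j k => (hcon j k).le)
    obtain ⟨h1, h2⟩ := (M n).discrepancy_nonneg_and_le_of_entrywise hMn.loadings hη hηlam hpn1 hclose (hVn ω)
    have hω' : δ ≤ ‖discrepancy (M n).B (V n ω) - 0‖ := hω
    rw [sub_zero, Real.norm_of_nonneg h1] at hω'
    linarith
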